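/- Let $\sigma>0$, $y>0$ and $\varepsilon\in(0,1)$. Let $\Gamma\sim N(0,(1-\varepsilon)\sigma^2)$ and $\Pi\sim\mathrm{Pois}(\theta)$ be independent, where $\theta:=\varepsilon\sigma^2/y^2$, and put $\eta:=\Gamma+y(\Pi-\theta)$. For $x\ge y$ let $$\mathrm{PU}(x):=\inf_{\lambda>0}e^{-\lambda x}\exp\Big\{\frac{\lambda^2}{2}(1-\varepsilon)\sigma^2+\frac{e^{\lambda y}-1-\lambda y}{y^2}\,\varepsilon\sigma^2\Big\},\qquad \mathrm{Pin}(x):=\inf_{t<x}\frac{\mathsf E(\eta-t)_+^3}{(x-t)^3},$$ where $u_+:=\max(u,0)$; let $x\mapsto\mathsf P^{\mathsf{LC}}(\eta\ge x)$ be the least log-concave majorant over $\mathbb R$ of the tail function $x\mapsto\mathsf P(\eta\ge x)$; and let $c_{3,0}:=\Gamma(4)(e/3)^3=2e^3/9$, where in this formula $\Gamma$ is the Gamma function. Write $f(x)\lesssim g(x)$ if there is a constant $C>0$, depending only on $\sigma,y,\varepsilon$, such that $f(x)\le C g(x)$ for all $x\ge y$. Then, for all $x\ge y$, $$\frac{\mathrm{PU}(x)}{x^{3/2}}\lesssim\mathsf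 P(\eta\ge x)\le\mathrm{Pin}(x)\le c_{3,0}\,\mathsf P^{\mathsf{LC}}(\eta\ge x)\lesssim x\,\mathsf P(\eta\ge x)\le x\,\mathrm{PU}(x).$$ Consequently, the four quantities $\mathrm{PU}(x)$, $\mathrm{Pin}(x)$, $c_{3,0}\,\mathsf P^{\mathsf{LC}}(\eta\ge x)$ and $\mathsf P(\eta\ge x)$ agree up to a factor of order $x^{5/2}$: there is a constant $C>0$, depending only on $\sigma,y,\varepsilon$, such that $A\le C x^{5/2}B$ for all $x\ge y$ and any two $A,B$ of these four quantities. -/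

import Mathlib

open MeasureTheory ProbabilityTheory

noncomputable section

namespace TailBounds

/-- `P(η ≥ x)` for a random variable `η` with distribution `ν`. -/
def tail (ν : Measure ℝ) (x : ℝ) : ℝ := ν.real (Set.Ici x)

/-- The distribution of `η = Γ + y (Π - θ)`, where `Γ ∼ N(0, (1 - ε) σ²)` and `Π ∼ Pois(θ)` are
independent and `θ = ε σ² / y²` (which is the mean of `Π`). -/
def etaLaw (σ y ε : ℝ) : Measure ℝ :=
  ((gaussianReal 0 ((1 - ε) * σ ^ 2).toNNReal).prod
      (poissonMeasure (ε * σ ^ 2 / y ^ 2).toNNReal)).map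
    (fun p : ℝ × ℕ => p.1 + y * ((p.2 : ℝ) - ε * σ ^ 2 / y ^ 2))

/-- The exponential-moment bound `PU_exp(lam)`. -/
def PUexp (σ y ε lam : ℝ) : ℝ :=
  Real.exp (lam ^ 2 / 2 * ((1 - ε) * σ ^ 2)
    + (Real.exp (lam * y) - 1 - lam * y) / y ^ 2 * (ε * σ ^ 2))

/-- `PU(x)`, the infimum of `e^{-lam x} PU_exp(lam)` over `lam > 0`. -/
def PU (σ y ε x : ℝ) : ℝ :=
  ⨅ lam : Set.Ioi (0 : ℝ), Real.exp (-(lam : ℝ) * x) * PUexp σ y ε lam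

/-- `P_α(η; x)`, the infimum of `E (η - t)_+^α / (x - t)^α` over `t < x`, for a random variable `η`
with distribution `ν` and `α > 0`, where `E η_+^α < ∞`. -/
def momentBound (α : ℝ) (ν : Measure ℝ) (x : ℝ) : ℝ :=
  ⨅ t : Set.Iio x, (∫ u, (max (u - (t : ℝ)) 0) ^ α ∂ν) / (x - (t : ℝ)) ^ α

/-- `Pin(x) = P_3(η; x)` for `η` with distribution `etaLaw σ y ε`. -/
def Pin (σ y ε x : ℝ) : ℝ := momentBound 3 (etaLaw σ y ε) x

/-- The constant `c_{α,0} = Γ(α + 1) (e / α)^α`, for `α > 0`. -/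
def cConst (α : ℝ) : ℝ := Real.Gamma (α + 1) * (Real.exp 1 / α) ^ α

/-- Log-concavity on `ℝ` of a nonnegative function (that may vanish). -/
def LogConcave (g : ℝ → ℝ) : Prop :=
  (∀ x, 0 ≤ g x) ∧
    ∀ a b s : ℝ, 0 < s → s < 1 → g a ^ (1 - s) * g b ^ s ≤ g ((1 - s) * a + s * b)

/-- The log-concave majorants over `ℝ` of the tail function of `ν`. -/
def lcMajorants (ν : Measure ℝ) : Set (ℝ → ℝ) :=
  {g | LogConcave g ∧ ∀ x, tail ν x ≤ g x}

/-- `P^LC(η ≥ x)`: the least log-concave majorant of the tail function of `ν`, at `x`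
(see `isLeast_lcTail`). -/
def lcTail (ν : Measure ℝ) (x : ℝ) : ℝ := ⨅ g : lcMajorants ν, (g : ℝ → ℝ) x

theorem one_mem_lcMajorants (ν : Measure ℝ) [IsProbabilityMeasure ν] :
    (fun _ => (1 : ℝ)) ∈ lcMajorants ν := by
  refine ⟨⟨fun _ => zero_le_one, fun a b s _ _ => by simp⟩, fun x => ?_⟩
  exact measureReal_le_one

theorem lcTail_le {ν : Measure ℝ} {g : ℝ → ℝ} (hg : g ∈ lcMajorants ν) (x : ℝ) :
    lcTail ν x ≤ g x :=
  ciInf_le (f := fun g : lcMajorants ν => (g : ℝ → ℝ) x)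
    ⟨0, by rintro _ ⟨h, rfl⟩; exact h.2.1.1 x⟩ ⟨g, hg⟩

/-- The function `lcTail ν` is indeed the least log-concave majorant of the tail function. -/
theorem isLeast_lcTail (ν : Measure ℝ) [IsProbabilityMeasure ν] :
    IsLeast (lcMajorants ν) (lcTail ν) := by
  haveI : Nonempty (lcMajorants ν) := ⟨⟨_, one_mem_lcMajorants ν⟩⟩
  have h0 : ∀ x, 0 ≤ lcTail ν x := fun x => le_ciInf fun g => g.2.1.1 x
  refine ⟨⟨⟨h0, fun a b s hs hs1 => le_ciInf fun g => ?_⟩, fun x => le_ciInf fun g => g.2.2 x⟩,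
    fun g hg x => lcTail_le hg x⟩
  refine le_trans ?_ (g.2.1.2 a b s hs hs1)
  exact mul_le_mul (Real.rpow_le_rpow (h0 a) (lcTail_le g.2 a) (by linarith))
    (Real.rpow_le_rpow (h0 b) (lcTail_le g.2 b) hs.le) (Real.rpow_nonneg (h0 b) _)
    (Real.rpow_nonneg (g.2.1.1 a) _)

instance isProbabilityMeasure_etaLaw (σ y ε : ℝ) : IsProbabilityMeasure (etaLaw σ y ε) :=
  Measure.isProbabilityMeasure_map (by fun_prop)

end TailBounds

end

namespace TailBounds

/-! Everything rests on two facts: each of the four quantities lies between the tail and a constant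
times PU, and PU exceeds the tail by at most a linear factor. The powers 3/2 and 5/2 then only
weaken that factor, since x is bounded below by y. Upper side: PU is an infimum of log-affine
functions of x, hence log-concave, and it majorizes the tail by Markov's inequality, so it dominates
the least log-concave majorant. That majorant lies under an exponential touching it at x, and
integrating the exponential gives the moment bound with constant `cConst`. Lower side
(`PU_le_mul_tail_of_saddle`): at the saddle parameter c, x is the mean of the exponentially tilted
law, whose Poisson part has mean μ = θe^{cy}. Keeping only the event that Π = ⌊μ⌋ and Γ covers the
rest loses a factor of order √μ from the Poisson weight and one of order 1 + c from the Gaussian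
tail. Both are O(√x). -/

/-! ### Moment bounds and the log-concave majorant. -/

/-- A positive log-concave function lies below an exponential function touching it at `x`. -/
theorem LogConcave.exists_le_exp {q : ℝ → ℝ} (hq : LogConcave q) (hpos : ∀ u, 0 < q u) (x : ℝ) :
    ∃ c : ℝ, ∀ u, q u ≤ q x * Real.exp (-c * (u - x)) := by
  have hconv : ConvexOn ℝ Set.univ (fun u => -Real.log (q u)) := by
    refine ⟨convex_univ, fun a _ b _ s t hs ht hst => ?_⟩
    rcases hs.eq_or_lt with rfl | hs
    · obtain rfl : t = 1 := by linarith
      simp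
    rcases ht.eq_or_lt with rfl | ht
    · obtain rfl : s = 1 := by linarith
      simp
    have h := hq.2 a b t ht (by linarith)
    have hs' : 1 - t = s := by linarith
    rw [hs'] at h
    have h2 := Real.log_le_log
      (mul_pos (Real.rpow_pos_of_pos (hpos a) _) (Real.rpow_pos_of_pos (hpos b) _)) h
    rw [Real.log_mul (Real.rpow_pos_of_pos (hpos a) _).ne' (Real.rpow_pos_of_pos (hpos b) _).ne',
      Real.log_rpow (hpos a), Real.log_rpow (hpos b)] at h2
    simp only [smul_eq_mul]
    linarith
  have hx : x ∈ interior (Set.univ : Set ℝ) := by simp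
  refine ⟨derivWithin (fun u => -Real.log (q u)) (Set.Ioi x) x, fun u => ?_⟩
  set c := derivWithin (fun u => -Real.log (q u)) (Set.Ioi x) x with hc
  have key : c * (u - x) ≤ Real.log (q x) - Real.log (q u) := by
    rcases lt_trichotomy u x with h | rfl | h
    · have h1 := (hconv.slope_le_leftDeriv_of_mem_interior (Set.mem_univ u) hx h).trans
        (hconv.leftDeriv_le_rightDeriv_of_mem_interior hx)
      rw [slope_def_field, div_le_iff₀ (by linarith)] at h1
      linarith
    · simp
    · have h1 := hconv.rightDeriv_le_slope_of_mem_interior hx (Set.mem_univ u) h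
      rw [slope_def_field, le_div_iff₀ (by linarith)] at h1
      linarith
  have h3 : Real.log (q u) ≤ Real.log (q x) + -c * (u - x) := by linarith
  calc q u = Real.exp (Real.log (q u)) := (Real.exp_log (hpos u)).symm
    _ ≤ Real.exp (Real.log (q x) + -c * (u - x)) := Real.exp_le_exp.2 h3
    _ = _ := by rw [Real.exp_add, Real.exp_log (hpos x)]

/-- By the layer-cake formula the moment is α ∫ s^(α-1) P(η ≥ t + s) ds, and the exponential tail
bound turns it into a Gamma integral. -/
theorem integral_max_sub_rpow_le {ν : Measure ℝ} [IsProbabilityMeasure ν] {α c A t : ℝ}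
    (hα : 0 < α) (hc : 0 < c) (hA : 0 ≤ A) (h : ∀ u, tail ν u ≤ A * Real.exp (-c * (u - t))) :
    ∫ u, (max (u - t) 0) ^ α ∂ν ≤ A * (Real.Gamma (α + 1) / c ^ α) := by
  have hI : IntegrableOn (fun s : ℝ => s ^ (α - 1) * Real.exp (-(c * s))) (Set.Ioi 0) := by
    have := integrableOn_rpow_mul_exp_neg_mul_rpow (p := 1) (s := α - 1) (b := c) (by linarith)
      one_pos hc
    simpa using this
  have hlin : ∫⁻ u, ENNReal.ofReal ((max (u - t) 0) ^ α) ∂ν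
      ≤ ENNReal.ofReal (A * (Real.Gamma (α + 1) / c ^ α)) := by
    rw [lintegral_rpow_eq_lintegral_meas_le_mul ν (f := fun u => max (u - t) 0)
      (.of_forall fun u => le_max_right _ _) (by fun_prop) hα]
    calc ENNReal.ofReal α * ∫⁻ s in Set.Ioi 0, ν {a | s ≤ max (a - t) 0} *
            ENNReal.ofReal (s ^ (α - 1))
        ≤ ENNReal.ofReal α * ∫⁻ s in Set.Ioi 0,
            ENNReal.ofReal (A * (s ^ (α - 1) * Real.exp (-(c * s)))) := by
          refine mul_le_mul' le_rfl (setLIntegral_mono' measurableSet_Ioi fun s hs => ?_)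
          have hset : {a | s ≤ max (a - t) 0} = Set.Ici (t + s) := by
            ext a
            have hs : 0 < s := hs
            simp only [Set.mem_ofPred_eq, le_max_iff, Set.mem_Ici]
            constructor
            · rintro (h | h) <;> linarith
            · intro h
              left
              linarith
          have hs' : (0 : ℝ) ≤ s ^ (α - 1) := Real.rpow_nonneg (le_of_lt hs) _
          rw [hset, ← ofReal_measureReal, ← ENNReal.ofReal_mul measureReal_nonneg]
          refine ENNReal.ofReal_le_ofReal ?_
          have h1 : ν.real (Set.Ici (t + s)) ≤ A * Real.exp (-c * (t + s - t)) := h (t + s)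
          have h2 : -c * (t + s - t) = -(c * s) := by ring
          rw [h2] at h1
          calc _ ≤ A * Real.exp (-(c * s)) * s ^ (α - 1) := by gcongr
            _ = _ := by ring
      _ = ENNReal.ofReal α * ENNReal.ofReal (∫ s in Set.Ioi 0,
            A * (s ^ (α - 1) * Real.exp (-(c * s)))) := by
          rw [← ofReal_integral_eq_lintegral_ofReal (hI.const_mul A)]
          refine (ae_restrict_iff' measurableSet_Ioi).2 (.of_forall fun s hs => ?_)
          have hs' : (0 : ℝ) ≤ s ^ (α - 1) := Real.rpow_nonneg (le_of_lt hs) _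
          positivity
      _ = _ := by
          rw [← ENNReal.ofReal_mul hα.le, integral_const_mul,
            Real.integral_rpow_mul_exp_neg_mul_Ioi hα hc, Real.Gamma_add_one hα.ne',
            Real.div_rpow zero_le_one hc.le, Real.one_rpow]
          congr 1
          ring
  rw [integral_eq_lintegral_of_nonneg_ae
    (.of_forall fun u => Real.rpow_nonneg (le_max_right _ _) _)
    (by fun_prop (disch := exact hα.le))]
  have hG : 0 < Real.Gamma (α + 1) := Real.Gamma_pos_of_pos (by linarith)
  exact ENNReal.toReal_le_of_le_ofReal (by positivity) hlin

theorem momentBound_le {α : ℝ} {ν : Measure ℝ} {x t : ℝ} (ht : t < x) :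
    momentBound α ν x ≤ (∫ u, (max (u - t) 0) ^ α ∂ν) / (x - t) ^ α := by
  refine ciInf_le (f := fun t : Set.Iio x =>
    (∫ u, (max (u - (t : ℝ)) 0) ^ α ∂ν) / (x - (t : ℝ)) ^ α) ⟨0, ?_⟩ ⟨t, ht⟩
  rintro _ ⟨⟨s, hs⟩, rfl⟩
  have hs : s < x := hs
  exact div_nonneg (integral_nonneg fun u => Real.rpow_nonneg (le_max_right _ _) _)
    (Real.rpow_nonneg (by linarith) _)

theorem momentBound_le_cConst_mul {ν : Measure ℝ} [IsProbabilityMeasure ν] {α c q x : ℝ}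
    (hα : 0 < α) (hc : 0 < c) (hq : 0 ≤ q) (h : ∀ u, tail ν u ≤ q * Real.exp (-c * (u - x))) :
    momentBound α ν x ≤ cConst α * q := by
  have hd : 0 < α / c := by positivity
  -- With d = x - t the bound is q Γ(α+1) e^{cd}/(cd)^α, minimal at cd = α.
  refine (momentBound_le (t := x - α / c) (by linarith)).trans ?_
  rw [sub_sub_cancel, div_le_iff₀ (by positivity)]
  refine (integral_max_sub_rpow_le (A := q * Real.exp α) hα hc (by positivity)
    fun u => (h u).trans_eq ?_).trans_eq ?_
  · rw [mul_assoc, ← Real.exp_add]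
    congr 2
    field_simp
    ring
  · rw [cConst, Real.div_rpow hα.le hc.le, Real.div_rpow (Real.exp_pos 1).le hα.le,
      ← Real.exp_mul, one_mul]
    have h1 : (0 : ℝ) < α ^ α := by positivity
    field_simp

theorem momentBound_le_cConst_mul_lcTail {ν : Measure ℝ} [IsProbabilityMeasure ν] {α x : ℝ}
    (hα : 0 < α) (hpos : ∀ u, 0 < tail ν u) (hx : lcTail ν x < 1) :
    momentBound α ν x ≤ cConst α * lcTail ν x := by
  obtain ⟨hlc, hmaj⟩ := (isLeast_lcTail ν).1
  have hq : ∀ u, 0 < lcTail ν u := fun u => (hpos u).trans_le (hmaj u)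
  obtain ⟨c, hc⟩ := hlc.exists_le_exp hq x
  refine momentBound_le_cConst_mul hα ?_ (hq x).le fun u => (hmaj u).trans (hc u)
  -- If c ≤ 0, the exponential is at most `lcTail ν x` < 1 to the left of x, whereas the tail tends
  -- to 1 at -∞.
  by_contra! hc0
  have hlim : Filter.Tendsto (tail ν) Filter.atBot (nhds 1) := by
    have h := tendsto_measure_Ici_atBot ν
    rw [measure_univ] at h
    exact (ENNReal.tendsto_toReal ENNReal.one_ne_top).comp h
  refine hx.not_ge (le_of_tendsto hlim ?_)
  filter_upwards [Filter.eventually_le_atBot x] with u hu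
  refine (hmaj u).trans ((hc u).trans (mul_le_of_le_one_right (hq x).le ?_))
  rw [Real.exp_le_one_iff]
  nlinarith

theorem tail_le_momentBound {ν : Measure ℝ} [IsProbabilityMeasure ν] {α x : ℝ}
    (hα : 0 < α) (hint : ∀ t, Integrable (fun u => (max (u - t) 0) ^ α) ν) :
    tail ν x ≤ momentBound α ν x := by
  have : Nonempty (Set.Iio x) := ⟨⟨x - 1, by simp⟩⟩
  refine le_ciInf fun ⟨t, ht⟩ => ?_
  have ht : t < x := ht
  have hxt : 0 < (x - t) ^ α := Real.rpow_pos_of_pos (by linarith) _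
  rw [le_div_iff₀ hxt]
  have h := mul_meas_ge_le_integral_of_nonneg (μ := ν)
    (f := fun u => (max (u - t) 0) ^ α)
    (.of_forall fun u => Real.rpow_nonneg (le_max_right _ _) _) (hint t) ((x - t) ^ α)
  refine le_trans ?_ h
  rw [mul_comm]
  gcongr
  refine measureReal_mono fun u hu => ?_
  have hu : x ≤ u := hu
  exact Real.rpow_le_rpow (by linarith) ((by linarith : x - t ≤ u - t).trans (le_max_left _ _))
    hα.le

/-! ### Exponential moments of η and the bound PU. -/

theorem hasSum_poisson_mul_exp (r : NNReal) (c : ℝ) :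
    HasSum (fun n : ℕ => Real.exp (-r) * r ^ n / n.factorial * Real.exp (c * n))
      (Real.exp (r * (Real.exp c - 1))) := by
  convert! (NormedSpace.expSeries_div_hasSum_exp (r * Real.exp c : ℝ)).mul_left
    (Real.exp (-r)) using 1
  · ext n
    rw [mul_pow, ← Real.exp_nat_mul, mul_comm c]
    ring
  · rw [← Real.exp_eq_exp_ℝ, ← Real.exp_add]
    congr 1
    ring

theorem integrable_exp_mul_poissonMeasure (r : NNReal) (c : ℝ) :
    Integrable (fun n : ℕ => Real.exp (c * n)) (poissonMeasure r) := by
  rw [integrable_poissonMeasure_iff]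
  simpa using (hasSum_poisson_mul_exp r c).summable

theorem integral_exp_mul_poissonMeasure (r : NNReal) (c : ℝ) :
    ∫ n : ℕ, Real.exp (c * n) ∂(poissonMeasure r) = Real.exp (r * (Real.exp c - 1)) := by
  rw [integral_poissonMeasure]
  simpa using (hasSum_poisson_mul_exp r c).tsum_eq

variable {σ y ε : ℝ}

theorem exp_mul_eta_eq (y m c : ℝ) :
    (fun p : ℝ × ℕ => Real.exp (c * (p.1 + y * ((p.2 : ℝ) - m))))
      = fun p => Real.exp (-(c * y * m)) * (Real.exp (c * p.1) * Real.exp (c * y * p.2)) := by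
  ext p
  rw [← Real.exp_add, ← Real.exp_add]
  congr 1
  ring

theorem integrable_exp_mul_etaLaw (σ y ε c : ℝ) :
    Integrable (fun u => Real.exp (c * u)) (etaLaw σ y ε) := by
  rw [etaLaw, integrable_map_measure (by fun_prop) (by fun_prop)]
  change Integrable (fun p : ℝ × ℕ => Real.exp (c * (p.1 + y * ((p.2 : ℝ) - _)))) _
  rw [exp_mul_eta_eq]
  exact ((integrable_exp_mul_gaussianReal c).mul_prod
    (integrable_exp_mul_poissonMeasure _ (c * y))).const_mul _

theorem integral_exp_mul_etaLaw (hε₀ : 0 ≤ ε) (hε₁ : ε ≤ 1) (c : ℝ) :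
    ∫ u, Real.exp (c * u) ∂(etaLaw σ y ε) = PUexp σ y ε c := by
  rw [etaLaw, integral_map (by fun_prop) (by fun_prop), exp_mul_eta_eq, integral_const_mul,
    integral_prod_mul (fun u : ℝ => Real.exp (c * u)) (fun n : ℕ => Real.exp (c * y * n)),
    integral_exp_mul_poissonMeasure]
  have hg := congrFun (mgf_id_gaussianReal (μ := 0) (v := ((1 - ε) * σ ^ 2).toNNReal)) c
  simp only [mgf, id] at hg
  have h1 : 0 ≤ 1 - ε := by linarith
  rw [hg, Real.coe_toNNReal _ (by positivity), Real.coe_toNNReal _ (by positivity), PUexp,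
    ← Real.exp_add, ← Real.exp_add]
  congr 1
  ring

theorem integrable_max_sub_rpow_etaLaw (σ y ε : ℝ) (t : ℝ) :
    Integrable (fun u => (max (u - t) 0) ^ (3 : ℝ)) (etaLaw σ y ε) := by
  refine ((integrable_exp_mul_etaLaw σ y ε 1).const_mul (6 * Real.exp (-t))).mono'
    (by fun_prop (disch := norm_num)) (.of_forall fun u => ?_)
  have h0 : 0 ≤ max (u - t) 0 := le_max_right _ _
  rw [Real.norm_of_nonneg (Real.rpow_nonneg h0 _), mul_assoc, ← Real.exp_add]
  rcases le_total (u - t) 0 with h | h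
  · rw [max_eq_right h, Real.zero_rpow (by norm_num)]
    positivity
  · rw [max_eq_left h]
    have h3 := Real.pow_div_factorial_le_exp (u - t) h 3
    have h4 : (u - t) ^ (3 : ℝ) = (u - t) ^ 3 := by exact_mod_cast Real.rpow_natCast (u - t) 3
    rw [h4, show -t + 1 * u = u - t by ring]
    norm_num [Nat.factorial] at h3
    linarith

theorem PU_le (σ y ε x : ℝ) {c : ℝ} (hc : 0 < c) :
    PU σ y ε x ≤ Real.exp (-c * x) * PUexp σ y ε c := by
  refine ciInf_le (f := fun c : Set.Ioi (0 : ℝ) => Real.exp (-(c : ℝ) * x) * PUexp σ y ε c)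
    ⟨0, ?_⟩ ⟨c, hc⟩
  rintro _ ⟨s, rfl⟩
  exact mul_nonneg (Real.exp_pos _).le (Real.exp_pos _).le

theorem tail_etaLaw_le_PU (hε₀ : 0 ≤ ε) (hε₁ : ε ≤ 1) (x : ℝ) :
    tail (etaLaw σ y ε) x ≤ PU σ y ε x := by
  have : Nonempty (Set.Ioi (0 : ℝ)) := ⟨⟨1, by simp⟩⟩
  refine le_ciInf fun ⟨c, hc⟩ => ?_
  have h := measure_ge_le_exp_mul_mgf (μ := etaLaw σ y ε) (X := id) (t := c) x (le_of_lt hc)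
    (integrable_exp_mul_etaLaw σ y ε c)
  simp only [mgf, id, integral_exp_mul_etaLaw hε₀ hε₁] at h
  exact h

theorem logConcave_PU (σ y ε : ℝ) : LogConcave (PU σ y ε) := by
  have : Nonempty (Set.Ioi (0 : ℝ)) := ⟨⟨1, by simp⟩⟩
  have h0 : ∀ x, 0 ≤ PU σ y ε x := fun x =>
    le_ciInf fun c => mul_nonneg (Real.exp_pos _).le (Real.exp_pos _).le
  refine ⟨h0, fun a b s hs hs1 => le_ciInf fun ⟨c, hc⟩ => ?_⟩
  calc PU σ y ε a ^ (1 - s) * PU σ y ε b ^ s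
      ≤ (Real.exp (-c * a) * PUexp σ y ε c) ^ (1 - s)
          * (Real.exp (-c * b) * PUexp σ y ε c) ^ s :=
        mul_le_mul (Real.rpow_le_rpow (h0 a) (PU_le σ y ε a hc) (by linarith))
          (Real.rpow_le_rpow (h0 b) (PU_le σ y ε b hc) hs.le) (Real.rpow_nonneg (h0 b) _)
          (Real.rpow_nonneg (mul_nonneg (Real.exp_pos _).le (Real.exp_pos _).le) _)
    _ = _ := by
      simp only [PUexp, ← Real.exp_add, ← Real.exp_mul]
      congr 1
      ring

theorem lcTail_etaLaw_le_PU (hε₀ : 0 ≤ ε) (hε₁ : ε ≤ 1) (x : ℝ) :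
    lcTail (etaLaw σ y ε) x ≤ PU σ y ε x :=
  lcTail_le ⟨logConcave_PU σ y ε, tail_etaLaw_le_PU hε₀ hε₁⟩ x

theorem PU_lt_one (hσ : 0 < σ) (hy : 0 < y) (hε₀ : 0 ≤ ε) (hε₁ : ε ≤ 1) {x : ℝ} (hx : 0 < x) :
    PU σ y ε x < 1 := by
  -- The first term gives e^{cy} - 1 - cy ≤ (cy)², so the exponent is at most -cx + c²σ²; the second
  -- makes this at most -cx/2.
  set c := min (1 / y) (x / (2 * σ ^ 2)) with hcdef
  have hc : 0 < c := by positivity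
  have hcy : c * y ≤ 1 := by
    rw [← le_div_iff₀ hy]
    exact min_le_left _ _
  have hcx : c * σ ^ 2 ≤ x / 2 := by
    have := min_le_right (1 / y) (x / (2 * σ ^ 2))
    rw [← hcdef, le_div_iff₀ (by positivity)] at this
    linarith
  refine (PU_le σ y ε x hc).trans_lt ?_
  rw [PUexp, ← Real.exp_add, Real.exp_lt_one_iff]
  have hcy0 : 0 < c * y := by positivity
  have h1 : Real.exp (c * y) - 1 - c * y ≤ (c * y) ^ 2 :=
    (le_abs_self _).trans (Real.abs_exp_sub_one_sub_id_le (by rwa [abs_of_pos hcy0]))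
  have h2 : (Real.exp (c * y) - 1 - c * y) / y ^ 2 ≤ c ^ 2 := by
    rw [div_le_iff₀ (by positivity)]
    linarith [mul_pow c y 2]
  have h3 : (Real.exp (c * y) - 1 - c * y) / y ^ 2 * (ε * σ ^ 2) ≤ c ^ 2 * (ε * σ ^ 2) := by
    gcongr
  have h4 : c * (c * σ ^ 2) ≤ c * (x / 2) := by gcongr
  have h5 : 0 ≤ c ^ 2 * σ ^ 2 * (1 - ε) := by
    have : 0 ≤ 1 - ε := by linarith
    positivity
  have h6 : 0 < c * x := by positivity
  nlinarith

/-! ### Lower bounds for Poisson weights, Gaussian tails and the tail of η. -/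

theorem factorial_le_stirling {n : ℕ} (hn : n ≠ 0) :
    (n.factorial : ℝ) ≤ Real.exp 1 * (√n * (n / Real.exp 1) ^ n) := by
  obtain ⟨m, rfl⟩ := Nat.exists_eq_succ_of_ne_zero hn
  have h : Stirling.stirlingSeq (m + 1) ≤ Stirling.stirlingSeq 1 :=
    Stirling.stirlingSeq'_antitone (Nat.zero_le m)
  rw [Stirling.stirlingSeq_one, Stirling.stirlingSeq, div_le_iff₀ (by positivity),
    Real.sqrt_mul (by norm_num)] at h
  refine h.trans_eq ?_
  field_simp

/-- The Poisson weights at the integer part of the mean decay at most like an inverse square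
root. -/
theorem exp_neg_two_le_poisson_weight {μ : ℝ} (hμ : 0 ≤ μ) :
    Real.exp (-2) ≤ μ ^ ⌊μ⌋₊ * Real.exp (-μ) / (⌊μ⌋₊).factorial * √((⌊μ⌋₊ : ℝ) + 1) := by
  set k := ⌊μ⌋₊ with hk
  have h1 : (k : ℝ) ≤ μ := Nat.floor_le hμ
  have h2 : μ < k + 1 := Nat.lt_floor_add_one μ
  rcases eq_or_ne k 0 with h0 | h0
  · rw [h0] at h2 ⊢
    simp at h2 ⊢
    linarith
  have hk0 : (0 : ℝ) < k := by positivity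
  have hf : (0 : ℝ) < k.factorial := by positivity
  rw [div_mul_eq_mul_div, le_div_iff₀ hf]
  calc Real.exp (-2) * k.factorial
      ≤ Real.exp (-2) * (Real.exp 1 * (√k * (k / Real.exp 1) ^ k)) := by
        gcongr
        exact factorial_le_stirling h0
    _ = k ^ k * Real.exp (-(k + 1)) * √k := by
        rw [div_pow, ← Real.exp_nat_mul, mul_one, show -((k : ℝ) + 1) = -2 + 1 - k by ring,
          Real.exp_sub, Real.exp_add]
        ring
    _ ≤ μ ^ k * Real.exp (-μ) * √(k + 1) := by
        gcongr
        linarith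

theorem le_gaussianReal_Ici {v : NNReal} (hv : v ≠ 0) {z : ℝ} (hz : 0 ≤ z) :
    (√(2 * Real.pi * v))⁻¹ * Real.exp (-(z ^ 2 + 3) / (2 * v)) / (1 + z)
      ≤ (gaussianReal 0 v).real (Set.Ici z) := by
  -- On [z, z + d] the square grows by at most 2zd + d² ≤ 3, so the density loses only a bounded
  -- factor.
  set d := 1 / (1 + z) with hd
  have hd0 : 0 < d := by positivity
  have hd1 : d * (1 + z) = 1 := by
    rw [hd]
    field_simp
  have hv0 : (0 : ℝ) < v := by positivity
  calc (√(2 * Real.pi * v))⁻¹ * Real.exp (-(z ^ 2 + 3) / (2 * v)) / (1 + z)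
      = ((√(2 * Real.pi * v))⁻¹ * Real.exp (-(z ^ 2 + 3) / (2 * v)))
          * volume.real (Set.Icc z (z + d)) := by
        rw [Real.volume_real_Icc_of_le (by linarith), hd]
        ring
    _ ≤ ∫ u in Set.Icc z (z + d), gaussianPDFReal 0 v u := by
        refine setIntegral_ge_of_const_le_real measurableSet_Icc (by simp) (fun u hu => ?_)
          (integrable_gaussianPDFReal 0 v).integrableOn
        rw [gaussianPDFReal]
        obtain ⟨hu1, hu2⟩ := hu
        have : (u - 0) ^ 2 ≤ z ^ 2 + 3 := by
          have : u ^ 2 ≤ (z + d) ^ 2 := pow_le_pow_left₀ (hz.trans hu1) hu2 2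
          nlinarith
        gcongr
    _ = (gaussianReal 0 v).real (Set.Icc z (z + d)) := by
        rw [measureReal_def, gaussianReal_apply_eq_integral 0 hv, ENNReal.toReal_ofReal]
        exact setIntegral_nonneg measurableSet_Icc fun u _ => gaussianPDFReal_nonneg _ _ _
    _ ≤ _ := measureReal_mono Set.Icc_subset_Ici_self

theorem le_tail_etaLaw (σ y ε x : ℝ) (k : ℕ) :
    (gaussianReal 0 ((1 - ε) * σ ^ 2).toNNReal).real
        (Set.Ici (x - y * (k - ε * σ ^ 2 / y ^ 2)))
      * (poissonMeasure (ε * σ ^ 2 / y ^ 2).toNNReal).real {k}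
      ≤ tail (etaLaw σ y ε) x := by
  rw [tail, etaLaw, measureReal_def (Measure.map _ _),
    Measure.map_apply (by fun_prop) measurableSet_Ici, ← measureReal_def, ← measureReal_prod_prod]
  refine measureReal_mono ?_
  rintro ⟨u, n⟩ ⟨hu, hn⟩
  obtain rfl : n = k := hn
  simp only [Set.mem_Ici, Set.mem_preimage] at hu ⊢
  linarith

theorem tail_etaLaw_pos (hσ : 0 < σ) (hy : 0 < y) (hε₀ : 0 < ε) (hε₁ : ε < 1) (x : ℝ) :
    0 < tail (etaLaw σ y ε) x := by
  have h1 : 0 < 1 - ε := by linarith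
  have hv : ((1 - ε) * σ ^ 2).toNNReal ≠ 0 := by
    rw [Ne, Real.toNNReal_eq_zero, not_le]
    positivity
  refine lt_of_lt_of_le (mul_pos ?_ (poissonMeasure_real_singleton_pos 0 ?_))
    (le_tail_etaLaw σ y ε x 0)
  · set a := x - y * ((0 : ℕ) - ε * σ ^ 2 / y ^ 2)
    exact lt_of_lt_of_le (by positivity) ((le_gaussianReal_Ici hv (le_max_right a 0)).trans
      (measureReal_mono (Set.Ici_subset_Ici.2 (le_max_left a 0))))
  · rw [Real.toNNReal_pos]
    positivity

/-! ### The saddle point estimate. -/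

/-- The parameter at which the exponential bound is optimal. -/
theorem exists_saddle {v θ x : ℝ} (hv : 0 < v) (hy : 0 ≤ y) (hθ : 0 ≤ θ) (hx : 0 < x) :
    ∃ c, 0 < c ∧ x = c * v + y * (θ * Real.exp (c * y) - θ) := by
  have hcont : ContinuousOn (fun c => c * v + y * (θ * Real.exp (c * y) - θ))
      (Set.Icc 0 (x / v)) := by fun_prop
  have h := intermediate_value_Icc (by positivity) hcont
  have hmem : x ∈ Set.Icc ((fun c => c * v + y * (θ * Real.exp (c * y) - θ)) 0)
      ((fun c => c * v + y * (θ * Real.exp (c * y) - θ)) (x / v)) := by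
    have h1 : 1 ≤ Real.exp (x / v * y) := Real.one_le_exp (by positivity)
    have h2 : 0 ≤ y * (θ * (Real.exp (x / v * y) - 1)) :=
      mul_nonneg hy (mul_nonneg hθ (by linarith))
    constructor
    · simpa using hx.le
    · simp only [div_mul_cancel₀ x hv.ne']
      linarith
  obtain ⟨c, ⟨hc0, -⟩, hc⟩ := h hmem
  refine ⟨c, lt_of_le_of_ne hc0 ?_, hc.symm⟩
  rintro rfl
  simp at hc
  exact hx.ne hc

/-- A lower bound on the tail at the saddle point, of the same exponential order as `PU`. -/
theorem PU_le_mul_tail_of_saddle (hσ : 0 < σ) (hy : 0 < y) (hε₀ : 0 < ε) (hε₁ : ε < 1)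
    {x c v θ : ℝ} (hvdef : v = (1 - ε) * σ ^ 2) (hθdef : θ = ε * σ ^ 2 / y ^ 2) (hc : 0 < c)
    (hx : x = c * v + y * (θ * Real.exp (c * y) - θ)) :
    PU σ y ε x ≤ Real.exp (2 + (y ^ 2 + 3) / (2 * v)) * √(2 * Real.pi * v)
      * ((1 + (c * v + y)) * √(θ * Real.exp (c * y) + 1)) * tail (etaLaw σ y ε) x := by
  have hε : 0 < 1 - ε := by linarith
  have hv : 0 < v := by rw [hvdef]; positivity
  have hθ : 0 < θ := by rw [hθdef]; positivity
  set μ := θ * Real.exp (c * y) with hμdef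
  have hμ : 0 < μ := by positivity
  set k := ⌊μ⌋₊ with hk
  have hk1 : (k : ℝ) ≤ μ := Nat.floor_le hμ.le
  have hk2 : μ < k + 1 := Nat.lt_floor_add_one μ
  -- This is the threshold left for Γ once Π = k; it exceeds the tilted Gaussian mean cv by less
  -- than y.
  set z := c * v + y * (μ - k) with hz
  have hz0 : 0 ≤ z := by
    have : 0 ≤ μ - k := by linarith
    positivity
  have hz1 : z ≤ c * v + y := by nlinarith
  have hvN : v.toNNReal ≠ 0 := by
    rw [Ne, Real.toNNReal_eq_zero, not_le]
    exact hv
  have hG := le_gaussianReal_Ici hvN hz0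
  have hT := le_tail_etaLaw σ y ε x k
  rw [← hvdef, ← hθdef, poissonMeasure_real_singleton, Real.coe_toNNReal _ hθ.le,
    show x - y * (k - θ) = z by rw [hx, hz]; ring] at hT
  rw [Real.coe_toNNReal _ hv.le] at hG
  have hP := exp_neg_two_le_poisson_weight hμ.le
  rw [← hk] at hP
  set S := √((k : ℝ) + 1)
  set G := √(2 * Real.pi * v)
  have hG0 : 0 < G := by positivity
  have hS0 : 0 < S := by positivity
  have hSμ : S ≤ √(μ + 1) := Real.sqrt_le_sqrt (by linarith)
  -- After expanding z², the terms linear in y(μ - k) cancel by the choice of c; only (y(μ -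
  -- k))²/(2v) ≤ y²/(2v) is lost.
  have hexpo : -c * x + (c ^ 2 / 2 * v + (Real.exp (c * y) - 1 - c * y) * θ)
      ≤ (y ^ 2 + 3) / (2 * v) + -(z ^ 2 + 3) / (2 * v) + (-θ - c * y * k + μ) := by
    have h1 : (y * (μ - k)) ^ 2 / (2 * v) ≤ y ^ 2 / (2 * v) := by
      gcongr
      nlinarith [mul_pos hy hy, mul_le_mul_of_nonneg_left (by linarith : μ - k ≤ 1) hy.le,
        mul_nonneg hy.le (by linarith : 0 ≤ μ - k)]
    have h2 : z ^ 2 / (2 * v) = c ^ 2 / 2 * v + c * (y * (μ - k)) + (y * (μ - k)) ^ 2 / (2 * v) := by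
      rw [hz]
      field_simp
      ring
    have h3 : (y ^ 2 + 3) / (2 * v) + -(z ^ 2 + 3) / (2 * v) = y ^ 2 / (2 * v) - z ^ 2 / (2 * v) := by
      ring
    have h4 : Real.exp (c * y) * θ = μ := by rw [hμdef]; ring
    rw [h3, h2, hx]
    linarith [h4]
  have hpow : μ ^ k = θ ^ k * Real.exp (c * y * k) := by
    rw [hμdef, mul_pow, ← Real.exp_nat_mul, mul_comm (k : ℝ)]
  have hPU : PU σ y ε x ≤ Real.exp (-c * x + (c ^ 2 / 2 * v
      + (Real.exp (c * y) - 1 - c * y) * θ)) := by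
    refine (PU_le σ y ε x hc).trans_eq ?_
    rw [PUexp, ← Real.exp_add, hvdef, hθdef]
    congr 1
    ring
  have hfac : (0 : ℝ) < k.factorial := by positivity
  calc PU σ y ε x ≤ _ := hPU
    _ ≤ _ := Real.exp_le_exp.2 hexpo
    _ = Real.exp (2 + (y ^ 2 + 3) / (2 * v)) * (Real.exp (-(z ^ 2 + 3) / (2 * v))
          * Real.exp (-θ - c * y * k + μ)) * Real.exp (-2) := by
        simp only [← Real.exp_add]
        congr 1
        ring
    _ ≤ Real.exp (2 + (y ^ 2 + 3) / (2 * v)) * (Real.exp (-(z ^ 2 + 3) / (2 * v))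
          * Real.exp (-θ - c * y * k + μ)) * (μ ^ k * Real.exp (-μ) / k.factorial * S) := by
        gcongr
    _ = Real.exp (2 + (y ^ 2 + 3) / (2 * v)) * G * ((1 + z) * S)
          * ((G⁻¹ * Real.exp (-(z ^ 2 + 3) / (2 * v)) / (1 + z))
            * (Real.exp (-θ) * θ ^ k / k.factorial)) := by
        have h5 : Real.exp (-θ - c * y * k + μ) * Real.exp (c * y * k) * Real.exp (-μ)
            = Real.exp (-θ) := by
          rw [← Real.exp_add, ← Real.exp_add]
          congr 1
          ring
        rw [hpow, ← h5]
        field_simp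
    _ ≤ Real.exp (2 + (y ^ 2 + 3) / (2 * v)) * G * ((1 + z) * S) * tail (etaLaw σ y ε) x := by
        gcongr
        exact le_trans (by gcongr) hT
    _ ≤ _ := by
        have : 0 ≤ tail (etaLaw σ y ε) x := measureReal_nonneg
        gcongr

/-- The exponential bound exceeds the tail by at most a linear factor. -/
theorem exists_PU_le_mul_tail (hσ : 0 < σ) (hy : 0 < y) (hε₀ : 0 < ε) (hε₁ : ε < 1) :
    ∃ C, 0 < C ∧ ∀ x, y ≤ x → PU σ y ε x ≤ C * (x * tail (etaLaw σ y ε) x) := by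
  obtain ⟨v, hvdef⟩ : ∃ v, v = (1 - ε) * σ ^ 2 := ⟨_, rfl⟩
  obtain ⟨θ, hθdef⟩ : ∃ θ, θ = ε * σ ^ 2 / y ^ 2 := ⟨_, rfl⟩
  have hε : 0 < 1 - ε := by linarith
  have hv : 0 < v := by rw [hvdef]; positivity
  have hθ : 0 < θ := by rw [hθdef]; positivity
  have hA : 0 < Real.exp (2 + (y ^ 2 + 3) / (2 * v)) * √(2 * Real.pi * v) := by positivity
  set A := Real.exp (2 + (y ^ 2 + 3) / (2 * v)) * √(2 * Real.pi * v)
  set B := (1 + y) / √y + v * √(2 / (θ * y ^ 3)) with hB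
  set D := 1 / y + (θ + 1) / y with hD
  refine ⟨A * (B * √D), by positivity, fun x hxy => ?_⟩
  have hx0 : 0 < x := by linarith
  obtain ⟨c, hc, hx⟩ := exists_saddle hv hy.le hθ.le hx0
  refine (PU_le_mul_tail_of_saddle hσ hy hε₀ hε₁ hvdef hθdef hc hx).trans ?_
  have hcy : 0 < c * y := by positivity
  have hxx : √x * √x = x := Real.mul_self_sqrt hx0.le
  -- Since x ≥ yθ(e^{cy} - 1) ≥ yθ(cy)²/2, c is O(√x). A logarithmic bound holds too but is not
  -- needed.
  have h1 : 1 + (c * v + y) ≤ B * √x := by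
    have hq := Real.quadratic_le_exp_of_nonneg hcy.le
    have h2 : c ^ 2 ≤ 2 / (θ * y ^ 3) * x := by
      rw [div_mul_eq_mul_div, le_div_iff₀ (by positivity)]
      have h3 : y * θ * (Real.exp (c * y) - 1) ≤ x := by
        rw [hx]
        nlinarith [mul_pos hc hv]
      have h4 : y * θ * ((c * y) ^ 2 / 2) ≤ y * θ * (Real.exp (c * y) - 1) := by
        gcongr
        linarith
      nlinarith
    have h5 : c ≤ √(2 / (θ * y ^ 3)) * √x := by
      rw [← Real.sqrt_mul (by positivity)]
      exact Real.le_sqrt_of_sq_le h2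
    have h6 : 1 + y ≤ (1 + y) / √y * √x := by
      rw [div_mul_eq_mul_div, le_div_iff₀ (by positivity)]
      gcongr
    rw [hB]
    nlinarith
  -- The saddle equation gives θe^{cy} ≤ x/y + θ, and θ + 1 ≤ (θ + 1)x/y because x ≥ y.
  have h2 : √(θ * Real.exp (c * y) + 1) ≤ √D * √x := by
    rw [← Real.sqrt_mul (by positivity)]
    refine Real.sqrt_le_sqrt ?_
    rw [hD, ← add_div, div_mul_eq_mul_div, le_div_iff₀ hy]
    nlinarith [mul_pos hc hv]
  have hT : 0 ≤ tail (etaLaw σ y ε) x := measureReal_nonneg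
  calc _ ≤ A * ((B * √x) * (√D * √x)) * tail (etaLaw σ y ε) x := by gcongr
    _ = A * (B * √D) * ((√x * √x) * tail (etaLaw σ y ε) x) := by ring
    _ = _ := by rw [hxx]

end TailBounds

/-! ### Assembling the chain. -/

theorem proposition3p14 (σ y ε : ℝ) (hσ : 0 < σ) (hy : 0 < y) (hε₀ : 0 < ε) (hε₁ : ε < 1) :
    (∃ C : ℝ, 0 < C ∧ ∀ x : ℝ, y ≤ x →
      TailBounds.PU σ y ε x / x ^ (3 / 2 : ℝ)
        ≤ C * TailBounds.tail (TailBounds.etaLaw σ y ε) x) ∧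
    (∀ x : ℝ, y ≤ x →
      TailBounds.tail (TailBounds.etaLaw σ y ε) x ≤ TailBounds.Pin σ y ε x) ∧
    (∀ x : ℝ, y ≤ x →
      TailBounds.Pin σ y ε x
        ≤ TailBounds.cConst 3 * TailBounds.lcTail (TailBounds.etaLaw σ y ε) x) ∧
    (∃ C : ℝ, 0 < C ∧ ∀ x : ℝ, y ≤ x →
      TailBounds.cConst 3 * TailBounds.lcTail (TailBounds.etaLaw σ y ε) x
        ≤ C * (x * TailBounds.tail (TailBounds.etaLaw σ y ε) x)) ∧
    (∀ x : ℝ, y ≤ x →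
      x * TailBounds.tail (TailBounds.etaLaw σ y ε) x ≤ x * TailBounds.PU σ y ε x) ∧
    (∃ C : ℝ, 0 < C ∧ ∀ x : ℝ, y ≤ x →
      ∀ A ∈ ({TailBounds.PU σ y ε x, TailBounds.Pin σ y ε x,
          TailBounds.cConst 3 * TailBounds.lcTail (TailBounds.etaLaw σ y ε) x,
          TailBounds.tail (TailBounds.etaLaw σ y ε) x} : Set ℝ),
      ∀ B ∈ ({TailBounds.PU σ y ε x, TailBounds.Pin σ y ε x,
          TailBounds.cConst 3 * TailBounds.lcTail (TailBounds.etaLaw σ y ε) x,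
          TailBounds.tail (TailBounds.etaLaw σ y ε) x} : Set ℝ),
        A ≤ C * x ^ (5 / 2 : ℝ) * B) := by
  have htail : ∀ x, TailBounds.tail (TailBounds.etaLaw σ y ε) x
      ≤ TailBounds.Pin σ y ε x := fun x => TailBounds.tail_le_momentBound (by norm_num)
    (TailBounds.integrable_max_sub_rpow_etaLaw σ y ε)
  have hPin : ∀ x, y ≤ x → TailBounds.Pin σ y ε x
      ≤ TailBounds.cConst 3 * TailBounds.lcTail (TailBounds.etaLaw σ y ε) x := fun x hx =>
    TailBounds.momentBound_le_cConst_mul_lcTail (by norm_num)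
      (TailBounds.tail_etaLaw_pos hσ hy hε₀ hε₁)
      ((TailBounds.lcTail_etaLaw_le_PU hε₀.le hε₁.le x).trans_lt
        (TailBounds.PU_lt_one hσ hy hε₀.le hε₁.le (hy.trans_le hx)))
  have hc : 0 < TailBounds.cConst 3 :=
    mul_pos (Real.Gamma_pos_of_pos (by norm_num)) (by positivity)
  have hlc : ∀ x, TailBounds.cConst 3 * TailBounds.lcTail (TailBounds.etaLaw σ y ε) x
      ≤ TailBounds.cConst 3 * TailBounds.PU σ y ε x := fun x =>
    mul_le_mul_of_nonneg_left (TailBounds.lcTail_etaLaw_le_PU hε₀.le hε₁.le x) hc.le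
  have hPU : ∀ x, TailBounds.tail (TailBounds.etaLaw σ y ε) x ≤ TailBounds.PU σ y ε x :=
    TailBounds.tail_etaLaw_le_PU hε₀.le hε₁.le
  have h0 : ∀ x, 0 < TailBounds.tail (TailBounds.etaLaw σ y ε) x :=
    TailBounds.tail_etaLaw_pos hσ hy hε₀ hε₁
  have hPU0 : ∀ x, 0 < TailBounds.PU σ y ε x := fun x => (h0 x).trans_le (hPU x)
  obtain ⟨C, hC, hmain⟩ := TailBounds.exists_PU_le_mul_tail hσ hy hε₀ hε₁
  -- Trades the linear factor for x^{3/2} (r = 1/2) and x^{5/2} (r = 3/2).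
  have hpow : ∀ r : ℝ, 0 < r → ∀ x, y ≤ x → x ≤ (y ^ r)⁻¹ * x ^ (r + 1) := by
    intro r hr x hx
    have hx0 : 0 < x := hy.trans_le hx
    have h1 : y ^ r ≤ x ^ r := Real.rpow_le_rpow hy.le hx hr.le
    have h2 : 0 < y ^ r := Real.rpow_pos_of_pos hy r
    rw [Real.rpow_add_one hx0.ne', ← mul_assoc]
    refine le_mul_of_one_le_left hx0.le ?_
    rwa [inv_mul_eq_div, one_le_div h2]
  refine ⟨⟨C * (y ^ (1 / 2 : ℝ))⁻¹, by positivity, fun x hx => ?_⟩, fun x _ => htail x, hPin,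
    ⟨TailBounds.cConst 3 * C, by positivity, fun x hx => ?_⟩, fun x hx => ?_,
    ⟨(1 + TailBounds.cConst 3) * C * (y ^ (3 / 2 : ℝ))⁻¹, by positivity, fun x hx A hA B hB => ?_⟩⟩
  · have hx0 : 0 < x := hy.trans_le hx
    have h1 := hpow (1 / 2) (by norm_num) x hx
    rw [show (1 / 2 + 1 : ℝ) = 3 / 2 by norm_num] at h1
    rw [div_le_iff₀ (Real.rpow_pos_of_pos hx0 _)]
    calc _ ≤ C * (x * TailBounds.tail (TailBounds.etaLaw σ y ε) x) := hmain x hx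
      _ ≤ C * ((y ^ (1 / 2 : ℝ))⁻¹ * x ^ (3 / 2 : ℝ)
            * TailBounds.tail (TailBounds.etaLaw σ y ε) x) := by
          have := (h0 x).le
          gcongr
      _ = _ := by ring
  · refine (hlc x).trans ?_
    rw [mul_assoc]
    exact mul_le_mul_of_nonneg_left (hmain x hx) hc.le
  · exact mul_le_mul_of_nonneg_left (hPU x) (hy.le.trans hx)
  · have h1 := hpow (3 / 2) (by norm_num) x hx
    rw [show (3 / 2 + 1 : ℝ) = 5 / 2 by norm_num] at h1
    have hx0 : 0 < x := hy.trans_le hx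
    have hcPU : 0 < TailBounds.cConst 3 * TailBounds.PU σ y ε x := mul_pos hc (hPU0 x)
    have hA' : A ≤ (1 + TailBounds.cConst 3) * TailBounds.PU σ y ε x := by
      rw [add_mul, one_mul]
      have := hPU0 x
      have := hlc x
      have := hPin x hx
      have := hPU x
      rcases hA with rfl | rfl | rfl | rfl <;> linarith
    have hB' : TailBounds.tail (TailBounds.etaLaw σ y ε) x ≤ B := by
      have := hPin x hx
      have := htail x
      have := hPU x
      rcases hB with rfl | rfl | rfl | rfl <;> linarith
    calc A ≤ (1 + TailBounds.cConst 3) * TailBounds.PU σ y ε x := hA'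
      _ ≤ (1 + TailBounds.cConst 3) * (C * (x * TailBounds.tail (TailBounds.etaLaw σ y ε) x)) := by
          gcongr
          exact hmain x hx
      _ ≤ (1 + TailBounds.cConst 3) * (C * ((y ^ (3 / 2 : ℝ))⁻¹ * x ^ (5 / 2 : ℝ) * B)) := by
          have := (h0 x).le
          gcongr
      _ = _ := by ring
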